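/- All graphs are finite, simple and undirected. A \emph{forbidden family} is a family $\mathcal{F}$ of connected bipartite graphs, each with at least three vertices. A \emph{colouring} of a graph $G$ is a function $c:V(G)\to\mathbb{Z}$ with $c(v)\neq c(w)$ for every edge $vw$; it is \emph{$\mathcal{F}$-free} if $|\{c(v):v\in V(H)\}|\geq 3$ for every subgraph $H$ of $G$ isomorphic to a graph in $\mathcal{F}$. The \emph{$\mathcal{F}$-free chromatic number} $\chi(G,\mathcal{F})$ is the minimum number of colours in an $\mathcal{F}$-free colouring of $G$. The \emph{span} of $c$ is $\max\{|c(v)-c(w)|:vw\in E(G)\}$ (and $0$ if $G$ has no edges), and the \emph{$\mathcal{F}$-free chromatic span} $\Lambda(G,\mathcal{F})$ is the minimum integer $k$ for which $G$ has an $\mathcal{F}$-free colouring with span $k$. In the cartesian product $G_1\square G_2\square\cdots\square G_d$ two vertices of $V(G_1)\times\cdots\times V(G_d)$ are adjacent if and only if they are adjacent in one coordinate and equal in all the others. Let $\gamma$ be Euler's constant and let $\log$ be the natural logarithm. \textbf{Theorem.} Let $\mathcal{F}$ be a forbidden family, let $d\geq 1$ and $k\geq 0$ be integers, and let $G_1,\dots,G_d$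 be graphs, each with $\Lambda(G_i,\mathcal{F})\leq k$ (which is implied if $\chi(G_i,\mathcal{F})\leq k+1$). Then $$\Lambda(G_1\square G_2\square\cdots\square G_d,\mathcal{F})\leq k(kd-k+1)\quad\text{and}\quad\chi(G_1\square G_2\square\cdots\square G_d,\mathcal{F})\leq 2k(kd-k+1)+1.$$ Moreover, for every integer $k\geq 2$ and every $0<\epsilon<1$ there is a number $d(k,\epsilon)$, depending only on $k$ and $\epsilon$, such that if $d>d(k,\epsilon)$ then, for all $\mathcal{F}$ and $G_1,\dots,G_d$ as above, $$\Lambda(G_1\square G_2\square\cdots\square G_d,\mathcal{F})\leq\frac{e^{\gamma}}{1-\epsilon}\,dk\log k\quad\text{and}\quad\chi(G_1\square G_2\square\cdots\square G_d,\mathcal{F})\leq 1+\frac{2e^{\gamma}}{1-\epsilon}\,dk\log k.$$ -/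

import Mathlib

universe u

/-- A family of finite graphs. Every finite graph is isomorphic to one whose vertex set is some
`Fin n`, so a set of such graphs describes an arbitrary family of finite graphs up to
isomorphism. -/
abbrev GraphFamily : Type := Set (Σ n : ℕ, SimpleGraph (Fin n))

/-- A forbidden family: connected bipartite graphs, each with at least three vertices. -/
def IsForbiddenFamily (𝓕 : GraphFamily) : Prop :=
  ∀ F ∈ 𝓕, F.2.Connected ∧ F.2.IsBipartite ∧ 3 ≤ F.1

/-- An `𝓕`-free colouring of `G`: a proper integer colouring such that every subgraph of `G` that
is isomorphic to a member of `𝓕` receives at least three colours. A copy of `F` in `G` is an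
injective homomorphism from `F` to `G`; its images are the subgraphs of `G` isomorphic to `F`. -/
def IsFreeColouring {V : Type*} (G : SimpleGraph V) (𝓕 : GraphFamily) (c : V → ℤ) : Prop :=
  (∀ v w, G.Adj v w → c v ≠ c w) ∧
    ∀ F ∈ 𝓕, ∀ f : SimpleGraph.Copy F.2 G, 3 ≤ (Set.range fun x => c (f x)).ncard

/-- The span of `c`: the maximum of `|c v - c w|` over the edges `vw` of `G`
(`0` if there are no edges). -/
noncomputable def colouringSpan {V : Type*} (G : SimpleGraph V) (c : V → ℤ) : ℕ :=
  sSup {m : ℕ | ∃ v w, G.Adj v w ∧ m = (c v - c w).natAbs}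

/-- The `𝓕`-free chromatic number: the least `k` such that some `𝓕`-free colouring of `G` uses at
most `k` colours. -/
noncomputable def freeChromaticNumber {V : Type*} (G : SimpleGraph V) (𝓕 : GraphFamily) : ℕ :=
  sInf {k : ℕ | ∃ c : V → ℤ, IsFreeColouring G 𝓕 c ∧ (Set.range c).ncard ≤ k}

/-- The `𝓕`-free chromatic span: the least `k` such that some `𝓕`-free colouring of `G` has
span `k`. -/
noncomputable def freeChromaticSpan {V : Type*} (G : SimpleGraph V) (𝓕 : GraphFamily) : ℕ :=
  sInf {k : ℕ | ∃ c : V → ℤ, IsFreeColouring G 𝓕 c ∧ colouringSpan G c = k}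

/-- The cartesian product of the graphs `G i`: two vertices are adjacent when they are adjacent in
one coordinate and equal in all others. -/
def cartesianProduct {ι : Type*} {V : ι → Type*} (G : ∀ i, SimpleGraph (V i)) :
    SimpleGraph (∀ i, V i) where
  Adj v w := ∃ i, (G i).Adj (v i) (w i) ∧ ∀ j, j ≠ i → v j = w j
  symm := ⟨fun _ _ ⟨i, h, h'⟩ => ⟨i, h.symm, fun j hj => (h' j hj).symm⟩⟩
  loopless := ⟨fun _ ⟨_, h, _⟩ => h.ne rfl⟩

/-- A finite graph has an `𝓕`-free colouring for every forbidden family `𝓕`, so both minima above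
are attained. -/
theorem exists_isFreeColouring {V : Type*} [Finite V] (G : SimpleGraph V) {𝓕 : GraphFamily}
    (h𝓕 : IsForbiddenFamily 𝓕) : ∃ c : V → ℤ, IsFreeColouring G 𝓕 c := by
  obtain ⟨n, ⟨e⟩⟩ := Finite.exists_equiv_fin V
  have hc : Function.Injective (fun v => ((e v : ℕ) : ℤ)) := fun v w h =>
    e.injective (Fin.ext (Int.ofNat.inj h))
  refine ⟨fun v => ((e v : ℕ) : ℤ), fun v w h h' => h.ne (hc h'), fun F hF f => ?_⟩
  have hi : Function.Injective (fun x => ((e (f x) : ℕ) : ℤ)) := hc.comp f.injective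
  have h3 := (h𝓕 F hF).2.2
  rw [← Set.image_univ, Set.ncard_image_of_injective _ hi, Set.ncard_univ]
  simpa using h3

/-! Colour each factor with span at most `k` and compose with a locally injective colouring `C` of
the product of copies of `intDistGraph k`. If a copy of some `F` had only two colours, local
injectivity would leave only two colour vectors along it. These differ in one coordinate `i`, so by
properness in the factors every edge of the copy runs in direction `i`, and the copy projects to a
two-coloured copy of `F` in `G i`, a contradiction (`freeChromaticSpan_cartesianProduct_le`). Only
the span of `C` then matters.

The linear form with coefficients `k * i + 1` gives the bound for all `d`. For large `d`,
`isLocallyInjectiveColouring_blowUp` uses one sequence for many coordinates and records the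
coordinate in a remainder modulo `N`. For `k ≥ 3` the identity sequence gives span `(k + 1) * d +
O(1)`; for `k = 2` seventeen alternating sequences give `41 / 17 * d + O(1)`. Both slopes are
strictly below `exp γ * k * log k`. Reduction modulo `2 * Λ + 1` turns span bounds into bounds on
the number of colours. -/

/-- The graph on `ℤ` joining distinct integers at distance at most `k`. -/
def intDistGraph (k : ℕ) : SimpleGraph ℤ where
  Adj a b := a ≠ b ∧ (a - b).natAbs ≤ k
  symm := ⟨fun a b h => ⟨h.1.symm, by have := h.2; omega⟩⟩
  loopless := ⟨fun _ h => h.1 rfl⟩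

/-- A proper integer colouring, of span at most `L`, in which the neighbours of every vertex have
distinct colours. -/
structure IsLocallyInjectiveColouring {V : Type*} (G : SimpleGraph V) (L : ℕ) (c : V → ℤ) :
    Prop where
  proper : ∀ v w, G.Adj v w → c v ≠ c w
  span_le : ∀ v w, G.Adj v w → (c v - c w).natAbs ≤ L
  inj : ∀ v w w', G.Adj v w → G.Adj v w' → c w = c w' → w = w'

/-! ### Spans and optimal colourings -/

theorem colouringSpan_le {V : Type*} {G : SimpleGraph V} {c : V → ℤ} {L : ℕ}
    (h : ∀ v w, G.Adj v w → (c v - c w).natAbs ≤ L) : colouringSpan G c ≤ L := by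
  refine csSup_le' ?_
  rintro m ⟨v, w, hvw, rfl⟩
  exact h v w hvw

theorem natAbs_sub_le_colouringSpan {V : Type*} [Finite V] {G : SimpleGraph V} (c : V → ℤ)
    {v w : V} (h : G.Adj v w) : (c v - c w).natAbs ≤ colouringSpan G c := by
  refine le_csSup ?_ ⟨v, w, h, rfl⟩
  refine ((Set.finite_range fun p : V × V => (c p.1 - c p.2).natAbs).subset ?_).bddAbove
  rintro m ⟨v, w, -, rfl⟩
  exact ⟨(v, w), rfl⟩

theorem freeChromaticSpan_le {V : Type*} {G : SimpleGraph V} {𝓕 : GraphFamily} {c : V → ℤ} {L : ℕ}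
    (hc : IsFreeColouring G 𝓕 c) (h : ∀ v w, G.Adj v w → (c v - c w).natAbs ≤ L) :
    freeChromaticSpan G 𝓕 ≤ L :=
  le_trans (Nat.sInf_le ⟨c, hc, rfl⟩) (colouringSpan_le h)

theorem exists_isFreeColouring_span_le {V : Type*} [Finite V] (G : SimpleGraph V)
    {𝓕 : GraphFamily} (h𝓕 : IsForbiddenFamily 𝓕) :
    ∃ c : V → ℤ, IsFreeColouring G 𝓕 c ∧
      ∀ v w, G.Adj v w → (c v - c w).natAbs ≤ freeChromaticSpan G 𝓕 := by
  obtain ⟨c₀, hc₀⟩ := exists_isFreeColouring G h𝓕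
  obtain ⟨c, hc, h⟩ : freeChromaticSpan G 𝓕 ∈
      {k : ℕ | ∃ c : V → ℤ, IsFreeColouring G 𝓕 c ∧ colouringSpan G c = k} :=
    Nat.sInf_mem ⟨_, c₀, hc₀, rfl⟩
  exact ⟨c, hc, fun v w hvw => h ▸ natAbs_sub_le_colouringSpan c hvw⟩

/-! ### Two-coloured subgraphs; comparing `χ` with `Λ` -/

/-- If a colouring `φ` determines the type `X` of a vertex from its colour and the type of any
neighbour, then a connected graph with two colours has only two types. -/
theorem eq_or_eq_of_ncard_range_lt_three {V α β : Type*} [Finite V] {H : SimpleGraph V}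
    (hH : H.Connected) {X : V → α} {φ : V → β} (hφ : ∀ v w, H.Adj v w → φ v ≠ φ w)
    (hX : ∀ v w v' w', H.Adj v w → H.Adj v' w' → X v = X v' → φ w = φ w' → X w = X w')
    (hXφ : ∀ v w, X v = X w → φ v = φ w)
    (h3 : (Set.range φ).ncard < 3) {a b : V} (hab : H.Adj a b) (w : V) :
    X w = X a ∨ X w = X b := by
  have two : ∀ w, φ w = φ a ∨ φ w = φ b := by
    intro w
    by_contra! hw
    have h : ({φ w, φ a, φ b} : Set β).ncard = 3 :=
      Set.ncard_eq_three.2 ⟨_, _, _, hw.1, hw.2, hφ a b hab, rfl⟩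
    have : ({φ w, φ a, φ b} : Set β) ⊆ Set.range φ := by
      rintro x (rfl | rfl | rfl) <;> exact ⟨_, rfl⟩
    have := Set.ncard_le_ncard this (Set.finite_range φ)
    omega
  obtain ⟨p⟩ := hH.preconnected w a
  induction p with
  | nil => exact Or.inl rfl
  | @cons v v' a hv p ih =>
    have hne := hφ v v' hv
    rcases ih hab two with h | h
    · have h' := hXφ _ _ h
      rcases two v with hv2 | hv2
      · exact absurd (hv2.trans h'.symm) hne
      · exact Or.inr (hX v' v a b hv.symm hab h hv2)
    · have h' := hXφ _ _ h
      rcases two v with hv2 | hv2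
      · exact Or.inl (hX v' v b a hv.symm hab.symm h hv2)
      · exact absurd (hv2.trans h'.symm) hne

theorem exists_adj_of_connected {n : ℕ} (hn : 3 ≤ n) {H : SimpleGraph (Fin n)}
    (hH : H.Connected) : ∃ a b, H.Adj a b := by
  have : Nontrivial (Fin n) := Fin.nontrivial_iff_two_le.2 (by omega)
  obtain ⟨b, hb⟩ := hH.preconnected.exists_adj_of_nontrivial ⟨0, by omega⟩
  exact ⟨_, b, hb⟩

theorem ncard_range_lt_three {V α β : Type*} {X : V → α} (f : α → β) {a b : V}
    (h : ∀ w, X w = X a ∨ X w = X b) : (Set.range fun w => f (X w)).ncard < 3 := by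
  have hs : (Set.range fun w => f (X w)) ⊆ {f (X a), f (X b)} := by
    rintro _ ⟨w, rfl⟩
    rcases h w with h | h <;> simp [h]
  have h1 := Set.ncard_le_ncard hs (by simp)
  have h2 := Set.ncard_insert_le (f (X a)) {f (X b)}
  rw [Set.ncard_singleton] at h2
  omega

/-- Neighbours of a vertex have colours within `2 * L` of each other, so residues modulo `2 * L + 1`
still tell them apart, and a copy with two residues has only two colours. -/
theorem freeChromaticNumber_le_two_mul_freeChromaticSpan {V : Type*} [Finite V]
    (G : SimpleGraph V) {𝓕 : GraphFamily} (h𝓕 : IsForbiddenFamily 𝓕) :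
    freeChromaticNumber G 𝓕 ≤ 2 * freeChromaticSpan G 𝓕 + 1 := by
  obtain ⟨c, hc, hL⟩ := exists_isFreeColouring_span_le G h𝓕
  set L := freeChromaticSpan G 𝓕
  have key : ∀ x y : ℤ, x % (2 * L + 1) = y % (2 * L + 1) → (x - y).natAbs ≤ 2 * L → x = y := by
    intro x y h hxy
    have h1 : (2 * L + 1 : ℤ) ∣ x - y := Int.ModEq.dvd (Eq.symm h)
    have := Int.eq_zero_of_abs_lt_dvd h1 (by rw [Int.abs_eq_natAbs]; omega)
    omega
  have hp : ∀ v w, G.Adj v w → c v % (2 * L + 1) ≠ c w % (2 * L + 1) := fun v w hvw h =>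
    hc.1 v w hvw (key _ _ h (by have := hL v w hvw; omega))
  refine Nat.sInf_le ⟨fun v => c v % (2 * L + 1), ⟨hp, fun F hF f => ?_⟩, ?_⟩
  · by_contra! h3
    obtain ⟨hconn, -, hn⟩ := h𝓕 F hF
    obtain ⟨a, b, hab⟩ := exists_adj_of_connected hn hconn
    have hadj : ∀ {v w}, F.2.Adj v w → G.Adj (f v) (f w) := fun h => f.toHom.map_adj h
    refine absurd (hc.2 F hF f) (not_le.2 (ncard_range_lt_three (X := fun x => c (f x)) id
      (eq_or_eq_of_ncard_range_lt_three hconn (fun v w h => hp _ _ (hadj h)) ?_ ?_ h3 hab)))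
    · intro v w v' w' h h' hX hφ
      have h1 := hL _ _ (hadj h)
      have h2 := hL _ _ (hadj h')
      exact key _ _ hφ (by omega)
    · intro v w h
      exact congrArg (· % (2 * L + 1 : ℤ)) h
  · have hs : (Set.range fun v => c v % (2 * L + 1 : ℤ)) ⊆ Set.Ico (0 : ℤ) (2 * L + 1) := by
      rintro _ ⟨v, rfl⟩
      exact ⟨Int.emod_nonneg _ (by omega), Int.emod_lt_of_pos _ (by omega)⟩
    refine (Set.ncard_le_ncard hs (Set.finite_Ico _ _)).trans ?_
    rw [← Finset.coe_Ico, Set.ncard_coe_finset, Int.card_Ico]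
    omega

theorem freeChromaticSpan_le_of_freeChromaticNumber_le {V : Type*} [Finite V]
    (G : SimpleGraph V) {𝓕 : GraphFamily} (h𝓕 : IsForbiddenFamily 𝓕) {k : ℕ}
    (h : freeChromaticNumber G 𝓕 ≤ k + 1) : freeChromaticSpan G 𝓕 ≤ k := by
  obtain ⟨c₀, hc₀⟩ := exists_isFreeColouring G h𝓕
  obtain ⟨c, hc, hn⟩ : freeChromaticNumber G 𝓕 ∈
      {k : ℕ | ∃ c : V → ℤ, IsFreeColouring G 𝓕 c ∧ (Set.range c).ncard ≤ k} :=
    Nat.sInf_mem ⟨_, c₀, hc₀, le_rfl⟩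
  let e := Finite.equivFin (Set.range c)
  have hlt : ∀ x, (e x : ℕ) ≤ k := fun x => by
    have h1 := (e x).2
    have h2 : Nat.card (Set.range c) = (Set.range c).ncard := rfl
    omega
  let g : Set.range c → ℤ := fun x => ((e x : ℕ) : ℤ)
  have hg : Function.Injective g := fun x y hxy => e.injective (Fin.ext (Int.ofNat.inj hxy))
  refine freeChromaticSpan_le (c := fun v => g (Set.rangeFactorization c v)) ⟨?_, ?_⟩ ?_
  · exact fun v w hvw hgv => hc.1 v w hvw (congrArg Subtype.val (hg hgv))
  · intro F hF f
    have h1 := hc.2 F hF f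
    have h2 : (Set.range fun x => c (f x)) =
        Subtype.val '' (Set.range fun x => Set.rangeFactorization c (f x)) := by
      rw [← Set.range_comp]; rfl
    have h3 : (Set.range fun x => g (Set.rangeFactorization c (f x))) =
        g '' (Set.range fun x => Set.rangeFactorization c (f x)) := by
      rw [← Set.range_comp]; rfl
    rw [h2, Set.ncard_image_of_injective _ Subtype.val_injective] at h1
    rwa [h3, Set.ncard_image_of_injective _ hg]
  · intro v w _
    have h1 := hlt (Set.rangeFactorization c v)
    have h2 := hlt (Set.rangeFactorization c w)
    simp only [g]
    omega

/-! ### Reduction to products of integer distance graphs -/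

/-- A locally injective colouring of the product of the graphs `intDistGraph k` composes with
`𝓕`-free colourings of span at most `k` of the factors. -/
theorem freeChromaticSpan_cartesianProduct_le {ι : Type*} [Finite ι] {V : ι → Type*}
    [∀ i, Finite (V i)] (G : ∀ i, SimpleGraph (V i)) {𝓕 : GraphFamily}
    (h𝓕 : IsForbiddenFamily 𝓕) {k L : ℕ} (hG : ∀ i, freeChromaticSpan (G i) 𝓕 ≤ k)
    {C : (ι → ℤ) → ℤ}
    (hC : IsLocallyInjectiveColouring (cartesianProduct fun _ : ι => intDistGraph k) L C) :
    freeChromaticSpan (cartesianProduct G) 𝓕 ≤ L := by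
  choose c hc hL using fun i => exists_isFreeColouring_span_le (G i) h𝓕
  let X : (∀ i, V i) → ι → ℤ := fun v i => c i (v i)
  have hX : ∀ {v w}, (cartesianProduct G).Adj v w →
      (cartesianProduct fun _ : ι => intDistGraph k).Adj (X v) (X w) := by
    rintro v w ⟨i, hi, hne⟩
    exact ⟨i, ⟨(hc i).1 _ _ hi, (hL i _ _ hi).trans (hG i)⟩, fun j hj => by simp only [X, hne j hj]⟩
  refine freeChromaticSpan_le (c := fun v => C (X v)) ⟨fun v w h => hC.proper _ _ (hX h), ?_⟩
    (fun v w h => hC.span_le _ _ (hX h))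
  intro F hF f
  by_contra! h3
  obtain ⟨hconn, -, hn⟩ := h𝓕 F hF
  obtain ⟨a, b, hab⟩ := exists_adj_of_connected hn hconn
  have hadj : ∀ {v w}, F.2.Adj v w → (cartesianProduct G).Adj (f v) (f w) :=
    fun h => f.toHom.map_adj h
  have htwo := eq_or_eq_of_ncard_range_lt_three (X := fun x => X (f x)) hconn
    (fun v w h => hC.proper _ _ (hX (hadj h)))
    (fun v w v' w' h h' hv hw => hC.inj _ _ _ (hX (hadj h))
      (by have := hX (hadj h'); rwa [← hv] at this) hw)
    (fun v w h => congrArg C h) h3 hab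
  obtain ⟨i, hi, hne⟩ := hadj hab
  have hoff : ∀ w, ∀ j, j ≠ i → X (f w) j = X (f a) j := by
    intro w j hj
    rcases htwo w with h | h
    · exact congrFun h j
    · rw [show X (f w) = X (f b) from h]
      simp only [X, hne j hj]
  have hdir : ∀ {v w}, F.2.Adj v w →
      (G i).Adj (f v i) (f w i) ∧ ∀ j, j ≠ i → f v j = f w j := by
    intro v w h
    obtain ⟨l, hl, hl'⟩ := hadj h
    -- An edge in another direction `l` would change the colour in coordinate `l`, which is constant
    -- on the copy.
    have : l = i := by
      by_contra hli
      exact (hc l).1 _ _ hl ((hoff v l hli).trans (hoff w l hli).symm)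
    subst this
    exact ⟨hl, hl'⟩
  have hconst : ∀ v w, ∀ j, j ≠ i → f v j = f w j := by
    intro v w j hj
    obtain ⟨p⟩ := hconn.preconnected v w
    induction p with
    | nil => rfl
    | cons h _ ih => exact ((hdir h).2 j hj).trans ih
  let f' : SimpleGraph.Copy F.2 (G i) :=
    ⟨⟨fun x => f x i, fun h => (hdir h).1⟩, fun v w h => f.injective (funext fun j => by
      by_cases hj : j = i
      · subst hj; exact h
      · exact hconst v w j hj)⟩
  exact absurd ((hc i).2 F hF f')
    (not_le.2 (ncard_range_lt_three (X := fun x => X (f x)) (fun x => x i) htwo))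

/-! ### Linear and blow-up colourings -/

theorem cartesianProduct_intDistGraph_adj {ι : Type*} [DecidableEq ι] {k : ℕ} {x y : ι → ℤ}
    (h : (cartesianProduct fun _ : ι => intDistGraph k).Adj x y) :
    ∃ i b, x i ≠ b ∧ (x i - b).natAbs ≤ k ∧ y = Function.update x i b := by
  obtain ⟨i, hi, hne⟩ := h
  refine ⟨i, y i, hi.1, hi.2, funext fun j => ?_⟩
  by_cases hj : j = i
  · subst hj; simp
  · simp [hj, hne j hj]

theorem sum_update {ι : Type*} [Fintype ι] [DecidableEq ι] (g : ι → ℤ → ℤ) (x : ι → ℤ) (i : ι)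
    (b : ℤ) :
    ∑ j, g j (Function.update x i b j) = ∑ j, g j (x j) + (g i b - g i (x i)) := by
  rw [← sub_eq_iff_eq_add', ← Finset.sum_sub_distrib, Finset.sum_eq_single i]
  · simp
  · intro j _ hj; simp [hj]
  · simp

/-- The linear colouring with coefficients `1, k + 1, 2 * k + 1, …`. -/
theorem isLocallyInjectiveColouring_linear (k d : ℕ) :
    IsLocallyInjectiveColouring (cartesianProduct fun _ : Fin d => intDistGraph k)
      (k * (k * d - k + 1)) (fun x => ∑ i : Fin d, ((k * i + 1 : ℕ) : ℤ) * x i) := by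
  have hs := fun (x : Fin d → ℤ) i b =>
    sum_update (fun (i : Fin d) y => ((k * i + 1 : ℕ) : ℤ) * y) x i b
  refine ⟨fun x y h => ?_, fun x y h => ?_, fun x y y' h h' hyy' => ?_⟩
  · obtain ⟨i, b, hb, -, rfl⟩ := cartesianProduct_intDistGraph_adj h
    rw [hs, ← mul_sub]
    have : ((k * i + 1 : ℕ) : ℤ) * (b - x i) ≠ 0 :=
      mul_ne_zero (by positivity) (sub_ne_zero.2 hb.symm)
    omega
  · obtain ⟨i, b, -, hb, rfl⟩ := cartesianProduct_intDistGraph_adj h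
    rw [hs, ← mul_sub, sub_add_cancel_left, Int.natAbs_neg, Int.natAbs_mul, Int.natAbs_natCast,
      mul_comm]
    refine Nat.mul_le_mul (by omega) (Nat.succ_le_succ ?_)
    rw [← Nat.mul_sub_one]
    exact Nat.mul_le_mul_left _ (by omega)
  · obtain ⟨i, b, hb, hbk, rfl⟩ := cartesianProduct_intDistGraph_adj h
    obtain ⟨j, b', hb', hbk', rfl⟩ := cartesianProduct_intDistGraph_adj h'
    rw [hs, hs, ← mul_sub, ← mul_sub, add_right_inj] at hyy'
    have habs := congrArg Int.natAbs hyy'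
    rw [Int.natAbs_mul, Int.natAbs_mul, Int.natAbs_natCast, Int.natAbs_natCast] at habs
    set m := (b - x i).natAbs with hm
    set m' := (b' - x j).natAbs with hm'
    have hm1 : m - 1 + 1 = m := by omega
    have hm1' : m' - 1 + 1 = m' := by omega
    -- Every coefficient is `1` modulo `k`, so the colour change reveals the step length modulo `k`;
    -- lengths lie in `1, …, k`, hence the shift by one.
    have hmod : m - 1 ≡ m' - 1 [MOD k] := by
      refine Nat.ModEq.add_right_cancel' 1 ?_
      rw [hm1, hm1']
      have h1 : (k * i + 1) * m ≡ m [MOD k] := by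
        simp [Nat.ModEq, add_mul, mul_assoc]
      have h2 : (k * j + 1) * m' ≡ m' [MOD k] := by
        simp [Nat.ModEq, add_mul, mul_assoc]
      exact h1.symm.trans (habs ▸ h2)
    have hmm : m = m' := by
      have := hmod.eq_of_lt_of_lt (by omega) (by omega)
      omega
    rw [hmm] at habs
    have h0 : 0 < m' := by omega
    have hij : i = j := by
      have h1 := Nat.eq_of_mul_eq_mul_right h0 habs
      have h2 : k * (i : ℕ) = k * j := by omega
      exact Fin.ext (Nat.eq_of_mul_eq_mul_left (by omega) h2)
    subst hij
    have := mul_left_cancel₀ (by positivity) hyy'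
    rw [show b = b' by omega]

/-- Blow-up of a family of integer sequences `E t`, whose short differences determine `t` and the
length of the step: a coordinate `i` follows the sequence `E (t i)`, and the coordinates with the
same sequence are told apart by a linear form modulo `N`. -/
theorem isLocallyInjectiveColouring_blowUp {ι T : Type*} [Fintype ι] {k L N : ℕ} (E : T → ℤ → ℤ)
    (hE0 : ∀ t a b, a ≠ b → (a - b).natAbs ≤ k → E t b - E t a ≠ 0 ∧ (E t b - E t a).natAbs ≤ L)
    (hE : ∀ t a b t' a' b', a ≠ b → (a - b).natAbs ≤ k → a' ≠ b' → (a' - b').natAbs ≤ k →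
      E t b - E t a = E t' b' - E t' a' → t = t' ∧ b - a = b' - a')
    (hN : ∀ m, 1 ≤ m → m ≤ k → Nat.Coprime N m) (hN0 : 0 < N) (t : ι → T) (z : ι → ℕ)
    (hz : ∀ i, z i < N) (htz : ∀ i j, t i = t j → z i = z j → i = j) :
    IsLocallyInjectiveColouring (cartesianProduct fun _ : ι => intDistGraph k) (N * (L + 1))
      (fun x => N * (∑ i, E (t i) (x i)) + (∑ i, (z i : ℤ) * x i) % N) := by
  classical
  have hs := fun (x : ι → ℤ) i b => sum_update (fun i y => E (t i) y) x i b
  have hr := fun (x : ι → ℤ) i b => sum_update (fun i y => (z i : ℤ) * y) x i b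
  have hN0' : (0 : ℤ) < N := by exact_mod_cast hN0
  have hr0 : ∀ a : ℤ, 0 ≤ a % N := fun a => Int.emod_nonneg _ hN0'.ne'
  have hr1 : ∀ a : ℤ, a % N < N := fun a => Int.emod_lt_of_pos _ hN0'
  refine ⟨fun x y h hxy => ?_, fun x y h => ?_, fun x y y' h h' hyy' => ?_⟩
  · obtain ⟨i, b, hb, hbk, rfl⟩ := cartesianProduct_intDistGraph_adj h
    simp only [hs, hr] at hxy
    have hD := (hE0 (t i) _ _ hb hbk).1
    have h1 := hr0 (∑ i, (z i : ℤ) * x i)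
    have h2 := hr1 (∑ i, (z i : ℤ) * x i)
    have h3 := hr0 (∑ i, (z i : ℤ) * x i + (z i * b - z i * x i))
    have h4 := hr1 (∑ i, (z i : ℤ) * x i + (z i * b - z i * x i))
    -- The main term moves by at least `N`, the remainder by less than `N`.
    rcases lt_or_gt_of_ne hD with h0 | h0 <;> nlinarith
  · obtain ⟨i, b, hb, hbk, rfl⟩ := cartesianProduct_intDistGraph_adj h
    simp only [hs, hr]
    have hD := (hE0 (t i) _ _ hb hbk).2
    have h1 := hr0 (∑ i, (z i : ℤ) * x i)
    have h2 := hr1 (∑ i, (z i : ℤ) * x i)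
    have h3 := hr0 (∑ i, (z i : ℤ) * x i + (z i * b - z i * x i))
    have h4 := hr1 (∑ i, (z i : ℤ) * x i + (z i * b - z i * x i))
    zify at hD ⊢
    rw [abs_le] at hD ⊢
    constructor <;> nlinarith
  · obtain ⟨i, b, hb, hbk, rfl⟩ := cartesianProduct_intDistGraph_adj h
    obtain ⟨j, b', hb', hbk', rfl⟩ := cartesianProduct_intDistGraph_adj h'
    simp only [hs, hr] at hyy'
    -- Quotient and remainder by `N` separate: the quotient gives the sequence and the step, the
    -- remainder the coordinate, as the step is invertible modulo `N`.
    have hmod := congrArg (· % (N : ℤ)) hyy'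
    simp only [Int.mul_add_emod_self_left, Int.emod_emod_of_dvd _ dvd_rfl] at hmod
    rw [hmod, add_left_inj, mul_right_inj' hN0'.ne', add_right_inj] at hyy'
    obtain ⟨htt, hbb⟩ := hE _ _ _ _ _ _ hb hbk hb' hbk' hyy'
    have h1 : (N : ℤ) ∣ (z i - z j) * (b - x i) := by
      have := Int.ModEq.dvd (show _ ≡ _ [ZMOD N] from hmod.symm)
      rw [add_sub_add_left_eq_sub, ← mul_sub, ← mul_sub, ← hbb, ← sub_mul] at this
      exact this
    have h2 : IsCoprime (N : ℤ) (b - x i) := by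
      rw [Int.isCoprime_iff_gcd_eq_one, Int.gcd, Int.natAbs_natCast]
      exact hN _ (by omega) (by omega)
    have h3 := Int.eq_zero_of_abs_lt_dvd (h2.dvd_of_dvd_mul_right h1)
      (by rw [abs_lt]; have := hz i; have := hz j; omega)
    have hij : i = j := htz i j htt (by omega)
    subst hij
    rw [show b = b' by omega]

/-! ### Alternating sequences for `k = 2` -/

/-- The sequence with differences alternately `p` and `q`. -/
def alternatingSeq (p q : ℕ) (x : ℤ) : ℤ := (p + q) * (x / 2) + p * (x % 2)

/-- Pairs `(p, q)` for which the sets `{p, q, p + q}` are pairwise disjoint. -/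
def stepPair : Fin 17 → ℕ × ℕ :=
  ![(3, 3), (5, 5), (9, 9), (11, 11), (12, 12), (13, 13), (15, 15), (16, 16), (17, 17), (19, 19),
    (20, 20), (1, 36), (2, 31), (4, 23), (7, 28), (8, 21), (14, 25)]

/-- The pair to which a step length belongs. -/
def stepOwner (n : ℕ) : Option (Fin 17) :=
  (List.finRange 17).find? fun t =>
    n = (stepPair t).1 ∨ n = (stepPair t).2 ∨ n = (stepPair t).1 + (stepPair t).2

/-- This encodes disjointness: if two pairs shared a length, the search would fail for the later
one. -/
theorem stepOwner_eq (t : Fin 17) :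
    stepOwner (stepPair t).1 = some t ∧ stepOwner (stepPair t).2 = some t ∧
      stepOwner ((stepPair t).1 + (stepPair t).2) = some t := by
  revert t; decide

theorem stepPair_bounds (t : Fin 17) :
    1 ≤ (stepPair t).1 ∧ 1 ≤ (stepPair t).2 ∧ (stepPair t).1 + (stepPair t).2 ≤ 40 := by
  revert t; decide

theorem alternatingSeq_sub (p q : ℕ) {a b : ℤ} (hab : a ≠ b) (h : (a - b).natAbs ≤ 2) :
    (b - a = 1 ∧ (alternatingSeq p q b - alternatingSeq p q a = p ∨
      alternatingSeq p q b - alternatingSeq p q a = q)) ∨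
    (b - a = -1 ∧ (alternatingSeq p q b - alternatingSeq p q a = -p ∨
      alternatingSeq p q b - alternatingSeq p q a = -q)) ∨
    (b - a = 2 ∧ alternatingSeq p q b - alternatingSeq p q a = p + q) ∨
    (b - a = -2 ∧ alternatingSeq p q b - alternatingSeq p q a = -(p + q)) := by
  unfold alternatingSeq
  obtain ⟨m, hm⟩ : ∃ m, m = a / 2 := ⟨_, rfl⟩
  have hcases : b - a = 1 ∨ b - a = -1 ∨ b - a = 2 ∨ b - a = -2 := by omega
  rcases Int.emod_two_eq_zero_or_one a with ha | ha <;>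
    rcases hcases with hc | hc | hc | hc
  · rw [show b / 2 = m by omega, show b % 2 = 1 by omega, ← hm, ha]
    exact Or.inl ⟨hc, Or.inl (by ring)⟩
  · rw [show b / 2 = m - 1 by omega, show b % 2 = 1 by omega, ← hm, ha]
    exact Or.inr (Or.inl ⟨hc, Or.inr (by ring)⟩)
  · rw [show b / 2 = m + 1 by omega, show b % 2 = 0 by omega, ← hm, ha]
    exact Or.inr (Or.inr (Or.inl ⟨hc, by ring⟩))
  · rw [show b / 2 = m - 1 by omega, show b % 2 = 0 by omega, ← hm, ha]
    exact Or.inr (Or.inr (Or.inr ⟨hc, by ring⟩))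
  · rw [show b / 2 = m + 1 by omega, show b % 2 = 0 by omega, ← hm, ha]
    exact Or.inl ⟨hc, Or.inr (by ring)⟩
  · rw [show b / 2 = m by omega, show b % 2 = 0 by omega, ← hm, ha]
    exact Or.inr (Or.inl ⟨hc, Or.inl (by ring)⟩)
  · rw [show b / 2 = m + 1 by omega, show b % 2 = 1 by omega, ← hm, ha]
    exact Or.inr (Or.inr (Or.inl ⟨hc, by ring⟩))
  · rw [show b / 2 = m - 1 by omega, show b % 2 = 1 by omega, ← hm, ha]
    exact Or.inr (Or.inr (Or.inr ⟨hc, by ring⟩))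

/-- The seventeen sets `{p, q, p + q}` partition `1, …, 40`, so no length up to `L = 40` is wasted.
The modulus is odd and exceeds every `i / 17`. -/
theorem exists_isLocallyInjectiveColouring_two (d : ℕ) :
    ∃ C, IsLocallyInjectiveColouring (cartesianProduct fun _ : Fin d => intDistGraph 2)
      ((2 * (d / 34) + 3) * 41) C := by
  let E : Fin 17 → ℤ → ℤ := fun t => alternatingSeq (stepPair t).1 (stepPair t).2
  have owner : ∀ t a b, a ≠ b → (a - b).natAbs ≤ 2 →
      stepOwner (E t b - E t a).natAbs = some t := by
    intro t a b hab h
    obtain ⟨h1, h2, h3⟩ := stepOwner_eq t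
    rcases alternatingSeq_sub (stepPair t).1 (stepPair t).2 hab h with
      ⟨-, h | h⟩ | ⟨-, h | h⟩ | ⟨-, h⟩ | ⟨-, h⟩ <;> simp only [E, h]
    · exact h1
    · exact h2
    · rwa [Int.natAbs_neg]
    · rwa [Int.natAbs_neg]
    · exact h3
    · rw [Int.natAbs_neg]; exact h3
  refine ⟨_, isLocallyInjectiveColouring_blowUp (k := 2) (L := 40) (N := 2 * (d / 34) + 3) E
    ?_ ?_ ?_ (by omega) (fun i : Fin d => (⟨i % 17, by omega⟩ : Fin 17)) (fun i => i / 17)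
    (fun i => by omega) ?_⟩
  · intro t a b hab h
    have hb := stepPair_bounds t
    rcases alternatingSeq_sub (stepPair t).1 (stepPair t).2 hab h with
      ⟨-, h | h⟩ | ⟨-, h | h⟩ | ⟨-, h⟩ | ⟨-, h⟩ <;> simp only [E, h] <;> omega
  · intro t a b t' a' b' hab h hab' h' heq
    have htt : t = t' := by
      have := owner t a b hab h
      rw [heq, owner t' a' b' hab' h'] at this
      exact (Option.some_injective _ this).symm
    subst htt
    refine ⟨rfl, ?_⟩
    simp only [E] at heq
    have hb := stepPair_bounds t
    rcases alternatingSeq_sub (stepPair t).1 (stepPair t).2 hab h with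
      ⟨h0, h | h⟩ | ⟨h0, h | h⟩ | ⟨h0, h⟩ | ⟨h0, h⟩ <;>
    rcases alternatingSeq_sub (stepPair t).1 (stepPair t).2 hab' h' with
      ⟨h0', h' | h'⟩ | ⟨h0', h' | h'⟩ | ⟨h0', h'⟩ | ⟨h0', h'⟩ <;> omega
  · intro m h1 h2
    interval_cases m
    · simp
    · rw [Nat.coprime_two_right, Nat.odd_iff]; omega
  · intro i j h1 h2
    simp only [Fin.mk.injEq] at h1
    exact Fin.ext (by omega)

theorem exists_isLocallyInjectiveColouring (k d : ℕ) :
    ∃ C, IsLocallyInjectiveColouring (cartesianProduct fun _ : Fin d => intDistGraph k)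
      ((d + k.factorial + 1) * (k + 1)) C := by
  have hf := k.factorial_pos
  have hd := Nat.div_add_mod d k.factorial
  have hd' := Nat.mod_lt d hf
  -- Being `1` modulo `k!`, `N` is coprime to all `m ≤ k`; it exceeds `d` by at most `k! + 1`.
  let N := k.factorial * (d / k.factorial + 1) + 1
  have hN : N = k.factorial * (d / k.factorial) + k.factorial + 1 := by simp only [N]; ring
  have hC := isLocallyInjectiveColouring_blowUp (k := k) (L := k) (N := N)
    (fun (_ : Unit) x => x) (fun _ a b h1 h2 => ⟨by omega, by omega⟩)
    (fun _ a b _ a' b' _ _ _ _ h => ⟨rfl, h⟩)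
    (fun m h1 h2 => by
      obtain ⟨c, hc⟩ := Nat.dvd_factorial h1 h2
      simp only [N]
      rw [hc, mul_assoc]
      simp)
    (by omega) (fun _ : Fin d => ()) (fun i => i) (fun i => by omega) (fun i j _ h => Fin.ext h)
  refine ⟨_, hC.proper, fun v w h => (hC.span_le v w h).trans ?_, hC.inj⟩
  exact Nat.mul_le_mul_right _ (by omega)

/-! ### Numerical bounds and asymptotics -/

theorem eulerMascheroniConstant_gt : 0.56 < Real.eulerMascheroniConstant := by
  -- Index 31 makes the logarithm `log 32 = 5 * log 2`.
  refine lt_trans ?_ (Real.eulerMascheroniSeq_lt_eulerMascheroniConstant 31)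
  have h32 : Real.log ((31 : ℕ) + 1) = 5 * Real.log 2 := by
    rw [show ((31 : ℕ) + 1 : ℝ) = 2 ^ 5 by norm_num, Real.log_pow]
    norm_num
  have h2 := Real.log_two_lt_d9
  have hH : (harmonic 31 : ℚ) > 4.027 := by norm_num [harmonic, Finset.sum_range_succ]
  have hH' : ((4.027 : ℚ) : ℝ) < (harmonic 31 : ℚ) := Rat.cast_lt.2 hH
  rw [Real.eulerMascheroniSeq, h32]
  norm_num at hH' ⊢
  linarith

theorem exp_eulerMascheroniConstant_gt : 1.75 < Real.exp Real.eulerMascheroniConstant := by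
  refine lt_trans ?_ (Real.exp_lt_exp.2 eulerMascheroniConstant_gt)
  refine lt_of_lt_of_le ?_ (Real.sum_le_exp_of_nonneg (by norm_num) 5)
  norm_num [Finset.sum_range_succ, Nat.factorial]

theorem exists_freeChromaticSpan_cartesianProduct_le (k : ℕ) (hk : 2 ≤ k) :
    ∃ A B : ℝ, A < Real.exp Real.eulerMascheroniConstant * (k * Real.log k) ∧
      ∀ (d : ℕ) (𝓕 : GraphFamily), IsForbiddenFamily 𝓕 →
      ∀ (V : Fin d → Type u) [∀ i, Finite (V i)] (G : ∀ i, SimpleGraph (V i)),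
        (∀ i, freeChromaticSpan (G i) 𝓕 ≤ k) →
          (freeChromaticSpan (cartesianProduct G) 𝓕 : ℝ) ≤ A * d + B := by
  have hγ := exp_eulerMascheroniConstant_gt
  rcases hk.eq_or_lt with rfl | hk
  -- The margin is thin: `41 / 17 ≈ 2.412` against `1.75 * 2 * log 2 ≈ 2.426`.
  · refine ⟨41 / 17, 123, ?_, fun d 𝓕 h𝓕 V _ G hG => ?_⟩
    · have := Real.log_two_gt_d9
      push_cast
      nlinarith
    · obtain ⟨C, hC⟩ := exists_isLocallyInjectiveColouring_two d
      have h1 := freeChromaticSpan_cartesianProduct_le G h𝓕 hG hC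
      have h2 : 17 * freeChromaticSpan (cartesianProduct G) 𝓕 ≤ 41 * d + 17 * 123 := by omega
      have h3 : (17 * freeChromaticSpan (cartesianProduct G) 𝓕 : ℝ) ≤ 41 * d + 17 * 123 := by
        exact_mod_cast h2
      linarith
  · refine ⟨k + 1, (k.factorial + 1) * (k + 1), ?_, fun d 𝓕 h𝓕 V _ G hG => ?_⟩
    · have hk3 : (3 : ℝ) ≤ k := by exact_mod_cast hk
      have hlog : 1 ≤ Real.log k := by
        rw [Real.le_log_iff_exp_le (by linarith)]
        linarith [Real.exp_one_lt_d9]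
      have h1 : (k : ℝ) ≤ k * Real.log k := le_mul_of_one_le_right (by linarith) hlog
      nlinarith
    · obtain ⟨C, hC⟩ := exists_isLocallyInjectiveColouring k d
      have h1 := freeChromaticSpan_cartesianProduct_le G h𝓕 hG hC
      have h3 : (freeChromaticSpan (cartesianProduct G) 𝓕 : ℝ) ≤
          (d + k.factorial + 1) * (k + 1) := by exact_mod_cast h1
      linarith

theorem mainTheorem1 :
    -- `χ(G, 𝓕) ≤ k + 1` implies `Λ(G, 𝓕) ≤ k`
    (∀ (𝓕 : GraphFamily), IsForbiddenFamily 𝓕 →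
      ∀ (k : ℕ) (V : Type u) [Finite V] (G : SimpleGraph V),
        freeChromaticNumber G 𝓕 ≤ k + 1 → freeChromaticSpan G 𝓕 ≤ k) ∧
    -- the bounds for all `k` and all `d ≥ 1` (so `k * d - k` is not truncated)
    (∀ (𝓕 : GraphFamily), IsForbiddenFamily 𝓕 →
      ∀ (k d : ℕ), 1 ≤ d →
      ∀ (V : Fin d → Type u) [∀ i, Finite (V i)] (G : ∀ i, SimpleGraph (V i)),
        (∀ i, freeChromaticSpan (G i) 𝓕 ≤ k) →
          freeChromaticSpan (cartesianProduct G) 𝓕 ≤ k * (k * d - k + 1) ∧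
          freeChromaticNumber (cartesianProduct G) 𝓕 ≤ 2 * k * (k * d - k + 1) + 1) ∧
    -- the bounds for `d` large in terms of `k` and `ε` only
    (∀ (k : ℕ), 2 ≤ k → ∀ (ε : ℝ), 0 < ε → ε < 1 → ∃ d₀ : ℕ, ∀ d : ℕ, d₀ < d →
      ∀ (𝓕 : GraphFamily), IsForbiddenFamily 𝓕 →
      ∀ (V : Fin d → Type u) [∀ i, Finite (V i)] (G : ∀ i, SimpleGraph (V i)),
        (∀ i, freeChromaticSpan (G i) 𝓕 ≤ k) →
          (freeChromaticSpan (cartesianProduct G) 𝓕 : ℝ) ≤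
            Real.exp Real.eulerMascheroniConstant / (1 - ε) * (d * k * Real.log k) ∧
          (freeChromaticNumber (cartesianProduct G) 𝓕 : ℝ) ≤
            1 + 2 * Real.exp Real.eulerMascheroniConstant / (1 - ε) * (d * k * Real.log k)) := by
  refine ⟨fun 𝓕 h𝓕 k V _ G h => freeChromaticSpan_le_of_freeChromaticNumber_le G h𝓕 h,
    fun 𝓕 h𝓕 k d _ V _ G hG => ?_, fun k hk ε hε hε1 => ?_⟩
  · have h1 := freeChromaticSpan_cartesianProduct_le G h𝓕 hG (isLocallyInjectiveColouring_linear k d)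
    have h2 := freeChromaticNumber_le_two_mul_freeChromaticSpan (cartesianProduct G) h𝓕
    exact ⟨h1, h2.trans (by rw [mul_assoc]; omega)⟩
  · obtain ⟨A, B, hA, hAB⟩ := exists_freeChromaticSpan_cartesianProduct_le.{u} k hk
    set M := Real.exp Real.eulerMascheroniConstant * (k * Real.log k) with hM
    have hA' : 0 < M - A := sub_pos.2 hA
    obtain ⟨d₀, hd₀⟩ := exists_nat_gt (B / (M - A))
    refine ⟨d₀, fun d hd 𝓕 h𝓕 V _ G hG => ?_⟩
    -- The strict gap `A < M` absorbs `B`, so the bound holds even without the factor `1 / (1 - ε)`.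
    have hB : B ≤ (M - A) * d := by
      rw [div_lt_iff₀' hA'] at hd₀
      have : (d₀ : ℝ) ≤ d := by exact_mod_cast hd.le
      nlinarith
    have hM0 : 0 ≤ M * d := by
      have := Real.log_natCast_nonneg k
      positivity
    have hspan : (freeChromaticSpan (cartesianProduct G) 𝓕 : ℝ) ≤
        Real.exp Real.eulerMascheroniConstant / (1 - ε) * (d * k * Real.log k) := by
      calc (freeChromaticSpan (cartesianProduct G) 𝓕 : ℝ) ≤ A * d + B := hAB d 𝓕 h𝓕 V G hG
        _ ≤ M * d := by linarith
        _ ≤ M * d / (1 - ε) := le_div_self hM0 (by linarith) (by linarith)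
        _ = _ := by rw [hM]; ring
    refine ⟨hspan, ?_⟩
    have h2 : (freeChromaticNumber (cartesianProduct G) 𝓕 : ℝ) ≤
        2 * freeChromaticSpan (cartesianProduct G) 𝓕 + 1 := by
      exact_mod_cast freeChromaticNumber_le_two_mul_freeChromaticSpan (cartesianProduct G) h𝓕
    rw [mul_div_assoc, mul_assoc]
    linarith
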